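/- Let $\mathcal L=(L,\sqcup,\sqcap,0,1)$ be a lattice semiring, i.e. the commutative semiring induced by a completely distributive complete lattice $(L,\le)$ with least element $0$ and greatest element $1$, $0\ne 1$; (infinitary) sums are suprema and (infinitary) products are infima. Let $\tau$ be a relational vocabulary (of arbitrary cardinality). First-order $\tau$-formulae are in negation normal form: they are built from the constants $\top,\bot$, the literals $R\bar x$, $\neg R\bar x$ ($R\in\tau$), $x=y$, $x\ne y$ by $\wedge,\vee,\exists,\forall$; $\mathrm{FO}(\tau)$ denotes the set of sentences. A (model-defining) $\mathcal L$-interpretation $\pi_A$ with non-empty universe $A$ assigns to all instantiated literals $R\bar a$, $\neg R\bar a$ with $\bar a$ from $A$ a value in $L$, such that for every atom $R\bar a$ precisely one of $\pi_A(R\bar a)$ and $\pi_A(\neg R\bar a)$ is $0$. It extends to all formulae instantiated in $A$ by evaluating $\top$ to $1$, $\bot$ to $0$, equalities and inequalities to their truth value in $\{0,1\}$, $\vee$ and $\exists$ by (infinitary) suprema, and $\wedge$ and $\forall$ by (infinitary) infima; the value of a sentence $\psi$ is $\pi_A[\![\psi]\!]$, and for a set of sentences $\pi_A[\![\Phi]\!]=\bigsqcap_{\varphi\in\Phi}\pi_A[\![\varphi]\!]$.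 Sets $\Phi,\Psi\subseteq\mathrm{FO}(\tau)$ are $\mathcal L$-equivalent, $\Phi\equiv_{\mathcal L}\Psi$, if $\pi[\![\Phi]\!]=\pi[\![\Psi]\!]$ for every $\mathcal L$-interpretation $\pi$. A sentence $\psi$ is identified with $\{\psi\}$ here and below. A homomorphism from $\pi_A$ to $\pi_B$ is a map $g:A\to B$ with $\bigsqcup_{\bar a':\,g(\bar a')=g(\bar a)}\pi_A(R\bar a')\le\pi_B(R\,g(\bar a))$ for all atoms $R\bar a$ over $A$ (equivalently, $\pi_A(R\bar a)\le\pi_B(R\,g(\bar a))$ for all atoms $R\bar a$ over $A$). $\pi_A$ is a subinterpretation of $\pi_B$, and $\pi_B$ an extension of $\pi_A$, written $\pi_A\subseteq\pi_B$, if $A\subseteq B$ and $\pi_A$ and $\pi_B$ agree on all literals over $A$. A set $\Phi$ of sentences is preserved in $\mathcal L$ under - homomorphisms, if $\pi_A[\![\Phi]\!]\le\pi_B[\![\Phi]\!]$ whenever there is a homomorphism from $\pi_A$ to $\pi_B$; - extensions, if $\pi_A[\![\Phi]\!]\le\pi_B[\![\Phi]\!]$ whenever $\pi_A\subseteq\pi_B$;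 - subinterpretations, if $\pi_B[\![\Phi]\!]\le\pi_A[\![\Phi]\!]$ whenever $\pi_A\subseteq\pi_B$. Let $\Sigma_1$ and $\Pi_1$ be the sets of sentences $\exists\bar x\,\theta(\bar x)$ and $\forall\bar x\,\theta(\bar x)$, respectively, with $\theta$ quantifier-free (and $\bar x$ possibly empty), and let $\Sigma_1^+\subseteq\Sigma_1$ be the set of those $\exists\bar x\,\theta(\bar x)$ in which the quantifier-free $\theta$ contains no negated literal ($\neg R\bar x$ or $x\neq y$). **Theorem.** (1) A sentence $\psi\in\mathrm{FO}(\tau)$ is preserved in $\mathcal L$ under homomorphisms if and only if $\psi\equiv_{\mathcal L}\varphi$ for some $\varphi\in\Sigma_1^+$; under extensions if and only if $\psi\equiv_{\mathcal L}\varphi$ for some $\varphi\in\Sigma_1$; under subinterpretations if and only if $\psi\equiv_{\mathcal L}\varphi$ for some $\varphi\in\Pi_1$. (2) A set $\Phi\subseteq\mathrm{FO}(\tau)$ is preserved in $\mathcal L$ under homomorphisms if and only if $\Phi\equiv_{\mathcal L}\Psi$ for some $\Psi\subseteq\Sigma_1^+$; under extensions if and only if $\Phi\equiv_{\mathcal L}\Psi$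 for some $\Psi\subseteq\Sigma_1$; under subinterpretations if and only if $\Phi\equiv_{\mathcal L}\Psi$ for some $\Psi\subseteq\Pi_1$. -/

import Mathlib

universe u v w

namespace SemiringSemantics

/-- Instantiated literals `R a₁ … aₖ` and `¬ R a₁ … aₖ` of a relational vocabulary `τ` over a
universe `A`. -/
inductive Lit (τ : FirstOrder.Language.{w, u}) (A : Type u) : Type u
  | pos {k : ℕ} (R : τ.Relations k) (a : Fin k → A) : Lit τ A
  | neg {k : ℕ} (R : τ.Relations k) (a : Fin k → A) : Lit τ A

/-- Replace the elements occurring in a literal along a map. -/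
def Lit.map {τ : FirstOrder.Language.{w, u}} {A B : Type u} (g : A → B) : Lit τ A → Lit τ B
  | .pos R a => .pos R (g ∘ a)
  | .neg R a => .neg R (g ∘ a)

/-- First-order formulae in negation normal form over the relational vocabulary `τ` (with equality
and the logical constants), with free variables indexed by `Fin n`. A quantifier in a formula with
`n` free variables binds the variable with the last index of `Fin (n + 1)`. -/
inductive Formula (τ : FirstOrder.Language.{w, u}) : ℕ → Type u
  | top {n : ℕ} : Formula τ n
  | bot {n : ℕ} : Formula τ n
  | eq {n : ℕ} (x y : Fin n) : Formula τ n
  | neq {n : ℕ} (x y : Fin n) : Formula τ n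
  | rel {n k : ℕ} (R : τ.Relations k) (x : Fin k → Fin n) : Formula τ n
  | nrel {n k : ℕ} (R : τ.Relations k) (x : Fin k → Fin n) : Formula τ n
  | and {n : ℕ} (φ ψ : Formula τ n) : Formula τ n
  | or {n : ℕ} (φ ψ : Formula τ n) : Formula τ n
  | all {n : ℕ} (φ : Formula τ (n + 1)) : Formula τ n
  | ex {n : ℕ} (φ : Formula τ (n + 1)) : Formula τ n

/-- Sentences are formulae without free variables. -/
abbrev Sentence (τ : FirstOrder.Language.{w, u}) : Type u := Formula τ 0

namespace Formula

variable {τ : FirstOrder.Language.{w, u}}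

/-- No quantifier occurs. -/
def QuantifierFree : {n : ℕ} → Formula τ n → Prop
  | _, .top => True
  | _, .bot => True
  | _, .eq _ _ => True
  | _, .neq _ _ => True
  | _, .rel _ _ => True
  | _, .nrel _ _ => True
  | _, .and φ ψ => φ.QuantifierFree ∧ ψ.QuantifierFree
  | _, .or φ ψ => φ.QuantifierFree ∧ ψ.QuantifierFree
  | _, .all _ => False
  | _, .ex _ => False

/-- No negated atom (neither `¬ R x₁ … xₖ` nor `x ≠ y`) occurs. -/
def NegationFree : {n : ℕ} → Formula τ n → Prop
  | _, .top => True
  | _, .bot => True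
  | _, .eq _ _ => True
  | _, .neq _ _ => False
  | _, .rel _ _ => True
  | _, .nrel _ _ => False
  | _, .and φ ψ => φ.NegationFree ∧ ψ.NegationFree
  | _, .or φ ψ => φ.NegationFree ∧ ψ.NegationFree
  | _, .all φ => φ.NegationFree
  | _, .ex φ => φ.NegationFree

/-- The sentence `∃ x₁ … ∃ xₙ φ`. -/
def exs : {n : ℕ} → Formula τ n → Sentence τ
  | 0, φ => φ
  | _ + 1, φ => exs (.ex φ)

/-- The sentence `∀ x₁ … ∀ xₙ φ`. -/
def alls : {n : ℕ} → Formula τ n → Sentence τ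
  | 0, φ => φ
  | _ + 1, φ => alls (.all φ)

end Formula

/-- Existential-positive sentences. -/
def SigmaOnePos (τ : FirstOrder.Language.{w, u}) : Set (Sentence τ) :=
  {ψ | ∃ (n : ℕ) (θ : Formula τ n), θ.QuantifierFree ∧ θ.NegationFree ∧ ψ = θ.exs}

/-- Existential sentences. -/
def SigmaOne (τ : FirstOrder.Language.{w, u}) : Set (Sentence τ) :=
  {ψ | ∃ (n : ℕ) (θ : Formula τ n), θ.QuantifierFree ∧ ψ = θ.exs}

/-- Universal sentences. -/
def PiOne (τ : FirstOrder.Language.{w, u}) : Set (Sentence τ) :=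
  {ψ | ∃ (n : ℕ) (θ : Formula τ n), θ.QuantifierFree ∧ ψ = θ.alls}

/-- An `S`-interpretation with universe `A`: a valuation of the instantiated literals in `S`. -/
abbrev Interp (τ : FirstOrder.Language.{w, u}) (A : Type u) (S : Type v) : Type (max u v) := Lit τ A → S

section Lattice

/-! The semiring operations of a lattice semiring are `0 = ⊥`, `1 = ⊤`, `+ = ⊔`, `· = ⊓`, with
infinitary sums `⨆` and infinitary products `⨅`; the natural order is the lattice order. -/

variable {τ : FirstOrder.Language.{w, u}} {A B : Type u} {S : Type v} [CompleteLattice S]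

/-- For all pairs of complementary literals, precisely one of the two has the value `0`. -/
def ModelDefining (π : Interp τ A S) : Prop :=
  ∀ (k : ℕ) (R : τ.Relations k) (a : Fin k → A), Xor (π (.pos R a) = ⊥) (π (.neg R a) = ⊥)

open Classical in
/-- The value of a formula under an assignment of its free variables. -/
noncomputable def eval (π : Interp τ A S) : {n : ℕ} → Formula τ n → (Fin n → A) → S
  | _, .top, _ => ⊤
  | _, .bot, _ => ⊥
  | _, .eq x y, s => if s x = s y then ⊤ else ⊥
  | _, .neq x y, s => if s x = s y then ⊥ else ⊤
  | _, .rel R x, s => π (.pos R (s ∘ x))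
  | _, .nrel R x, s => π (.neg R (s ∘ x))
  | _, .and φ ψ, s => eval π φ s ⊓ eval π ψ s
  | _, .or φ ψ, s => eval π φ s ⊔ eval π ψ s
  | _, .all φ, s => ⨅ a : A, eval π φ (Fin.snoc s a)
  | _, .ex φ, s => ⨆ a : A, eval π φ (Fin.snoc s a)

/-- The value of a sentence. -/
noncomputable def value (π : Interp τ A S) (ψ : Sentence τ) : S := eval π ψ Fin.elim0

/-- The value of a set of sentences: the product (infimum) of the values of its members. -/
noncomputable def setValue (π : Interp τ A S) (Φ : Set (Sentence τ)) : S := ⨅ φ ∈ Φ, value π φ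

/-- `g` is a homomorphism from `πA` to `πB`: for every atom `R a` over `A`, the sum of the values
`πA (R a')` over all tuples `a'` with `g a' = g a` is at most `πB (R (g a))`. -/
def IsHom (πA : Interp τ A S) (πB : Interp τ B S) (g : A → B) : Prop :=
  ∀ (k : ℕ) (R : τ.Relations k) (a : Fin k → A),
    (⨆ a' : {a' : Fin k → A // g ∘ a' = g ∘ a}, πA (.pos R a'.1)) ≤ πB (.pos R (g ∘ a))

/-- `πA`, whose universe is the subset `A` of `B`, is a subinterpretation of `πB`. -/
def IsSubinterp {A : Set B} (πA : Interp τ A S) (πB : Interp τ B S) : Prop :=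
  ∀ l : Lit τ A, πA l = πB (l.map Subtype.val)

theorem isHom_iff (πA : Interp τ A S) (πB : Interp τ B S) (g : A → B) :
    IsHom πA πB g ↔ ∀ (k : ℕ) (R : τ.Relations k) (a : Fin k → A),
      πA (.pos R a) ≤ πB (.pos R (g ∘ a)) := by
  constructor
  · intro h k R a
    exact (le_iSup (fun a' : {a' : Fin k → A // g ∘ a' = g ∘ a} => πA (.pos R a'.1))
      ⟨a, rfl⟩).trans (h k R a)
  · intro h k R a
    refine iSup_le fun a' => ?_
    exact (h k R a'.1).trans (le_of_eq (by rw [a'.2]))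

theorem setValue_singleton (π : Interp τ A S) (ψ : Sentence τ) :
    setValue π {ψ} = value π ψ := by
  simp [setValue]

end Lattice

section Preservation

variable {τ : FirstOrder.Language.{w, u}} (S : Type v) [CompleteLattice S]

/-- `S`-equivalence of two sets of sentences. Universes of interpretations are non-empty. -/
def Equivalent (Φ Ψ : Set (Sentence τ)) : Prop :=
  ∀ (A : Type u) [Nonempty A] (π : Interp τ A S), ModelDefining π → setValue π Φ = setValue π Ψ

/-- Preservation under homomorphisms in `S`. -/
def PreservedUnderHoms (Φ : Set (Sentence τ)) : Prop :=
  ∀ (A B : Type u) [Nonempty A] [Nonempty B] (πA : Interp τ A S) (πB : Interp τ B S),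
    ModelDefining πA → ModelDefining πB → (∃ g : A → B, IsHom πA πB g) →
      setValue πA Φ ≤ setValue πB Φ

/-- Preservation under extensions in `S`. -/
def PreservedUnderExtensions (Φ : Set (Sentence τ)) : Prop :=
  ∀ (B : Type u) (A : Set B) [Nonempty A] (πA : Interp τ A S) (πB : Interp τ B S),
    ModelDefining πA → ModelDefining πB → IsSubinterp πA πB →
      setValue πA Φ ≤ setValue πB Φ

/-- Preservation under subinterpretations in `S`. -/
def PreservedUnderSubinterps (Φ : Set (Sentence τ)) : Prop :=
  ∀ (B : Type u) (A : Set B) [Nonempty A] (πA : Interp τ A S) (πB : Interp τ B S),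
    ModelDefining πA → ModelDefining πB → IsSubinterp πA πB →
      setValue πB Φ ≤ setValue πA Φ

end Preservation

end SemiringSemantics

/-! The lattice is traded for truth values, where model-theoretic preservation arguments apply. Fix
`b` and call a literal true if `b` is completely below its value. Truth of a formula then lies
between `b` being completely below its value and `b` being below it (`eval_of_completelyBelow`,
`le_eval_of_completelyBelow`). By Raney's theorem values are recovered from such `b`, so entailment
over truth values gives inequality of values (`Entails.setValue_le`). An atom and its negation may
now both be false, except over a two-element lattice; the parameter `c` of `Consistent` records this
exception.

Conversely, `thresholdInterp` codes a truth-value interpretation in the lattice so that true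
sentences get `⊤` and false ones at most some `a ≠ ⊤`. Preservation of values thus yields
preservation of truth.

Ultraproducts and compactness survive undetermined atoms. Since falsity is not truth of a dual
sentence, the existential case (`PreservedAlong.exists_exClosures`) and the universal one
(`ReflectedAlong.exists_allClosures`) need separate diagram arguments. Compactness also reduces a
set to one sentence (`exists_mem_of_entails`). -/

namespace SemiringSemantics

open Filter

/-! ### The completely-below relation -/

section CompletelyBelow

variable {S : Type v} [CompletelyDistribLattice S]

/-- `b` is completely below `x`: every set whose supremum is at least `x` has an element
that is at least `b`. -/
def CompletelyBelow (b x : S) : Prop := ∀ T : Set S, x ≤ sSup T → ∃ t ∈ T, b ≤ t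

theorem CompletelyBelow.mono {b b' x x' : S} (h : CompletelyBelow b x) (hb : b' ≤ b)
    (hx : x ≤ x') : CompletelyBelow b' x' := fun T hT =>
  let ⟨t, ht, hbt⟩ := h T (hx.trans hT)
  ⟨t, ht, hb.trans hbt⟩

theorem CompletelyBelow.le {b x : S} (h : CompletelyBelow b x) : b ≤ x := by
  obtain ⟨t, rfl, ht⟩ := h {x} (by simp)
  exact ht

theorem not_completelyBelow_bot (b : S) : ¬ CompletelyBelow b ⊥ := fun h => by
  obtain ⟨t, ht, -⟩ := h ∅ bot_le
  exact ht

/-- Raney's characterization of complete distributivity. -/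
theorem sSup_completelyBelow (x : S) : sSup {b | CompletelyBelow b x} = x := by
  refine le_antisymm (sSup_le fun b hb => CompletelyBelow.le hb) ?_
  -- Distributivity turns this infimum over all covers of `x` into a supremum over choice functions.
  -- The infimum of the elements chosen by one function is below a member of every cover, hence
  -- completely below `x`.
  have h : x ≤ ⨅ T : {T : Set S // x ≤ sSup T}, ⨆ t : T.1, (t : S) :=
    le_iInf fun T => T.2.trans (sSup_eq_iSup' T.1).le
  rw [iInf_iSup_eq] at h
  refine h.trans (iSup_le fun g => le_sSup fun T hT => ?_)
  exact ⟨(g ⟨T, hT⟩ : S), (g ⟨T, hT⟩).2,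
    iInf_le (fun T : {T : Set S // x ≤ sSup T} => ((g T : T.1) : S)) ⟨T, hT⟩⟩

theorem le_of_forall_completelyBelow {x y : S} (h : ∀ b, CompletelyBelow b x → b ≤ y) :
    x ≤ y := by
  rw [← sSup_completelyBelow x]
  exact sSup_le h

/-- The elements completely below some `f i` already cover the supremum, so `b` is below one of
them. -/
theorem CompletelyBelow.exists_of_iSup {ι : Sort*} {f : ι → S} {b : S}
    (h : CompletelyBelow b (⨆ i, f i)) : ∃ i, CompletelyBelow b (f i) := by
  obtain ⟨c, ⟨i, hc⟩, hbc⟩ := h {c | ∃ i, CompletelyBelow c (f i)} (by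
    refine iSup_le fun i => le_of_forall_completelyBelow fun c hc => le_sSup ⟨i, hc⟩)
  exact ⟨i, hc.mono hbc le_rfl⟩

theorem CompletelyBelow.or_of_sup {x y b : S} (h : CompletelyBelow b (x ⊔ y)) :
    CompletelyBelow b x ∨ CompletelyBelow b y := by
  rw [sup_eq_iSup] at h
  obtain ⟨i, hi⟩ := h.exists_of_iSup
  cases i
  · exact Or.inr hi
  · exact Or.inl hi

end CompletelyBelow

variable {τ : FirstOrder.Language.{w, u}} {A B : Type u}

/-! ### Truth-value interpretations -/

/-- No atom holds together with its negation and, if `c`, every atom or its negation holds. -/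
def Consistent (c : Prop) (P : Interp τ A Prop) : Prop :=
  ∀ (k : ℕ) (R : τ.Relations k) (a : Fin k → A),
    ¬ (P (.pos R a) ∧ P (.neg R a)) ∧ (c → P (.pos R a) ∨ P (.neg R a))

/-- Every member of the set of sentences is true. -/
def Models (P : Interp τ A Prop) (Φ : Set (Sentence τ)) : Prop := ∀ φ ∈ Φ, value P φ

/-! ### From entailment over truth values to inequalities of lattice values -/

section Transfer

variable {S : Type v} [CompletelyDistribLattice S]

/-- Suprema split by `exists_of_iSup`; infima need only monotonicity. The converse can fail at
infima, which is why `le_eval_of_completelyBelow` concludes only `≤`. -/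
theorem eval_of_completelyBelow (π : Interp τ A S) (b : S) {n : ℕ} (φ : Formula τ n)
    (s : Fin n → A) (h : CompletelyBelow b (eval π φ s)) :
    eval (fun l => CompletelyBelow b (π l)) φ s := by
  induction φ with
  | top => simp [eval]
  | bot => exact (not_completelyBelow_bot b h).elim
  | eq x y =>
    by_cases hxy : s x = s y
    · simp [eval, hxy]
    · simp only [eval, hxy, if_false] at h
      exact (not_completelyBelow_bot b h).elim
  | neq x y =>
    by_cases hxy : s x = s y
    · simp only [eval, hxy, if_true] at h
      exact (not_completelyBelow_bot b h).elim
    · simp [eval, hxy]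
  | rel R x => exact h
  | nrel R x => exact h
  | and φ ψ ih₁ ih₂ =>
    exact ⟨ih₁ s (h.mono le_rfl inf_le_left), ih₂ s (h.mono le_rfl inf_le_right)⟩
  | or φ ψ ih₁ ih₂ => exact h.or_of_sup.imp (ih₁ s) (ih₂ s)
  | all φ ih =>
    simp only [eval, iInf_Prop_eq] at h ⊢
    exact fun a => ih _ (h.mono le_rfl (iInf_le _ a))
  | ex φ ih =>
    simp only [eval, iSup_Prop_eq] at h ⊢
    exact h.exists_of_iSup.imp fun a ha => ih _ ha

theorem le_eval_of_completelyBelow (π : Interp τ A S) (b : S) {n : ℕ} (φ : Formula τ n)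
    (s : Fin n → A) (h : eval (fun l => CompletelyBelow b (π l)) φ s) : b ≤ eval π φ s := by
  induction φ with
  | top => simp [eval]
  | bot => exact h.elim
  | eq x y =>
    by_cases hxy : s x = s y
    · simp [eval, hxy]
    · simp [eval, hxy] at h
  | neq x y =>
    by_cases hxy : s x = s y
    · simp [eval, hxy] at h
    · simp [eval, hxy]
  | rel R x => exact CompletelyBelow.le h
  | nrel R x => exact CompletelyBelow.le h
  | and φ ψ ih₁ ih₂ => exact le_inf (ih₁ s h.1) (ih₂ s h.2)
  | or φ ψ ih₁ ih₂ =>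
    exact h.elim (fun h => le_sup_of_le_left (ih₁ s h)) fun h => le_sup_of_le_right (ih₂ s h)
  | all φ ih =>
    simp only [eval, iInf_Prop_eq] at h ⊢
    exact le_iInf fun a => ih _ (h a)
  | ex φ ih =>
    simp only [eval, iSup_Prop_eq] at h ⊢
    obtain ⟨a, ha⟩ := h
    exact le_iSup_of_le a (ih _ ha)

/-- Every element is `⊥` or `⊤`. -/
def TwoValued (S : Type v) [CompleteLattice S] : Prop := ∀ x : S, x = ⊥ ∨ x = ⊤

/-- Nothing is completely below `⊥`, so one of two complementary literals is false. Over two values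
the other has value `⊤`, and `hb` then makes it true. -/
theorem consistent_completelyBelow {π : Interp τ A S} (hπ : ModelDefining π) {b x : S}
    (hb : CompletelyBelow b x) :
    Consistent (TwoValued S) fun l => CompletelyBelow b (π l) := by
  intro k R a
  refine ⟨?_, fun hS => ?_⟩
  · rintro ⟨h₁, h₂⟩
    rcases hπ k R a with h | h
    · rw [h.1] at h₁
      exact not_completelyBelow_bot b h₁
    · rw [h.1] at h₂
      exact not_completelyBelow_bot b h₂
  · rcases hπ k R a with h | h
    · exact Or.inr (hb.mono le_rfl (((hS _).resolve_left h.2).symm ▸ le_top))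
    · exact Or.inl (hb.mono le_rfl (((hS _).resolve_left h.2).symm ▸ le_top))

/-- Entailment over truth-value interpretations. -/
def Entails (c : Prop) (Φ Ψ : Set (Sentence τ)) : Prop :=
  ∀ (A : Type u) [Nonempty A] (P : Interp τ A Prop), Consistent c P → Models P Φ → Models P Ψ

theorem Entails.setValue_le {Φ Ψ : Set (Sentence τ)} (h : Entails (TwoValued S) Φ Ψ)
    [Nonempty A] {π : Interp τ A S} (hπ : ModelDefining π) : setValue π Φ ≤ setValue π Ψ := by
  refine le_of_forall_completelyBelow fun b hb => le_iInf₂ fun ψ hψ => ?_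
  refine le_eval_of_completelyBelow π b ψ _ (h A _ (consistent_completelyBelow hπ hb) ?_ ψ hψ)
  exact fun φ hφ => eval_of_completelyBelow π b φ _ (hb.mono le_rfl (iInf₂_le φ hφ))

theorem equivalent_of_entails {Φ Ψ : Set (Sentence τ)} (h₁ : Entails (TwoValued S) Φ Ψ)
    (h₂ : Entails (TwoValued S) Ψ Φ) : Equivalent S Φ Ψ :=
  fun _ _ _ hπ => le_antisymm (h₁.setValue_le hπ) (h₂.setValue_le hπ)

end Transfer

/-! ### Coding truth-value interpretations in the lattice -/

section Threshold

variable {S : Type v} [CompleteLattice S]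

open Classical in
/-- True literals get the value `⊤`, and undetermined atoms get `⊥` and their negations `a`. -/
noncomputable def thresholdInterp (a : S) (P : Interp τ A Prop) : Interp τ A S
  | .pos R x => if P (.pos R x) then ⊤ else ⊥
  | .neg R x => if P (.pos R x) then ⊥ else if P (.neg R x) then ⊤ else a

theorem modelDefining_thresholdInterp [Nontrivial S] {c : Prop} {a : S} (ha : a = ⊥ → c)
    {P : Interp τ A Prop} (hP : Consistent c P) : ModelDefining (thresholdInterp a P) := by
  intro k R x
  obtain ⟨-, h₂⟩ := hP k R x
  by_cases h : P (.pos R x)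
  · exact Or.inr (by simp [thresholdInterp, h])
  · refine Or.inl ?_
    by_cases h' : P (.neg R x)
    · simp [thresholdInterp, h, h']
    -- An undetermined atom refutes `c`, so here `a` is nonzero and the negated literal is the one
    -- with nonzero value.
    · have : a ≠ ⊥ := fun e => (h₂ (ha e)).elim h h'
      simp [thresholdInterp, h, h', this]

/-- Being `⊤` and being at most `a` behave under arbitrary suprema and infima exactly as true and
false do. -/
theorem eval_thresholdInterp {c : Prop} (a : S) {P : Interp τ A Prop} (hP : Consistent c P)
    {n : ℕ} (φ : Formula τ n) (s : Fin n → A) :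
    (eval P φ s → eval (thresholdInterp a P) φ s = ⊤) ∧
      (¬ eval P φ s → eval (thresholdInterp a P) φ s ≤ a) := by
  induction φ with
  | top => simp [eval]
  | bot => simp [eval]
  | eq x y => by_cases hxy : s x = s y <;> simp [eval, hxy]
  | neq x y => by_cases hxy : s x = s y <;> simp [eval, hxy]
  | rel R x =>
    simp only [eval, thresholdInterp]
    exact ⟨fun h => if_pos h, fun h => by simp [h]⟩
  | nrel R x =>
    simp only [eval, thresholdInterp]
    refine ⟨fun h => ?_, fun h => ?_⟩
    · rw [if_neg fun h' => (hP _ R (s ∘ x)).1 ⟨h', h⟩, if_pos h]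
    · rw [if_neg h]
      split_ifs <;> simp
  | and φ ψ ih₁ ih₂ =>
    simp only [eval]
    refine ⟨fun h => by rw [(ih₁ s).1 h.1, (ih₂ s).1 h.2, inf_top_eq], fun h => ?_⟩
    by_cases h₁ : eval P φ s
    · exact inf_le_of_right_le ((ih₂ s).2 fun h₂ => h ⟨h₁, h₂⟩)
    · exact inf_le_of_left_le ((ih₁ s).2 h₁)
  | or φ ψ ih₁ ih₂ =>
    simp only [eval]
    refine ⟨fun h => h.elim (fun h => ?_) fun h => ?_, fun h => ?_⟩
    · rw [(ih₁ s).1 h, top_sup_eq]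
    · rw [(ih₂ s).1 h, sup_top_eq]
    · exact sup_le ((ih₁ s).2 fun h' => h (Or.inl h')) ((ih₂ s).2 fun h' => h (Or.inr h'))
  | all φ ih =>
    simp only [eval, iInf_Prop_eq, not_forall]
    exact ⟨fun h => iInf_eq_top.2 fun x => (ih _).1 (h x),
      fun ⟨x, hx⟩ => iInf_le_of_le x ((ih _).2 hx)⟩
  | ex φ ih =>
    simp only [eval, iSup_Prop_eq, not_exists]
    exact ⟨fun ⟨x, hx⟩ => top_le_iff.1 (le_iSup_of_le x ((ih _).1 hx).ge),
      fun h => iSup_le fun x => (ih _).2 (h x)⟩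

theorem setValue_thresholdInterp_eq_top {c : Prop} (a : S) {P : Interp τ A Prop}
    (hP : Consistent c P) {Φ : Set (Sentence τ)} (h : Models P Φ) :
    setValue (thresholdInterp a P) Φ = ⊤ :=
  iInf₂_eq_top.2 fun φ hφ => (eval_thresholdInterp a hP φ _).1 (h φ hφ)

theorem models_of_top_le_setValue {c : Prop} {a : S} (ha : a ≠ ⊤) {P : Interp τ A Prop}
    (hP : Consistent c P) {Φ : Set (Sentence τ)} (h : ⊤ ≤ setValue (thresholdInterp a P) Φ) :
    Models P Φ := by
  intro φ hφ
  by_contra hn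
  exact ha (top_le_iff.1 (h.trans ((iInf₂_le φ hφ).trans ((eval_thresholdInterp a hP φ _).2 hn))))

/-- A third element can serve as the value of negated undetermined atoms; without one, `⊥` suffices
because no atom is undetermined. -/
theorem exists_threshold (S : Type v) [CompleteLattice S] [Nontrivial S] :
    ∃ a : S, a ≠ ⊤ ∧ (a = ⊥ → TwoValued S) := by
  by_cases h : TwoValued S
  · exact ⟨⊥, bot_ne_top, fun _ => h⟩
  · simp only [TwoValued, not_forall, not_or] at h
    obtain ⟨a, h₁, h₂⟩ := h
    exact ⟨a, h₂, fun e => (h₁ e).elim⟩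

end Threshold

/-! ### Ultraproducts -/

section Ultraproduct

variable {I : Type u} (U : Ultrafilter I) {M : I → Type u}

/-- The element of an ultraproduct represented by a family. -/
def ultraMk (f : ∀ i, M i) : (U : Filter I).Product M := Quotient.mk _ f

/-- A family representing an element of an ultraproduct. -/
noncomputable def ultraOut (x : (U : Filter I).Product M) : ∀ i, M i := Quotient.out x

theorem ultraMk_out (x : (U : Filter I).Product M) : ultraMk U (ultraOut U x) = x :=
  Quotient.out_eq x

theorem ultraMk_eq {f g : ∀ i, M i} : ultraMk U f = ultraMk U g ↔ ∀ᶠ i in U, f i = g i :=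
  Quotient.eq

theorem ultraOut_mk (f : ∀ i, M i) : ∀ᶠ i in U, ultraOut U (ultraMk U f) i = f i :=
  (ultraMk_eq U).1 (ultraMk_out U _)

/-- The ultraproduct of truth-value interpretations. -/
def ultraproduct (P : ∀ i, Interp τ (M i) Prop) : Interp τ ((U : Filter I).Product M) Prop :=
  fun l => ∀ᶠ i in U, P i (l.map fun x => ultraOut U x i)

variable (P : ∀ i, Interp τ (M i) Prop)

/-- Arities are finite, so the large sets for the single coordinates intersect in a large set. Hence
literals in the ultraproduct do not depend on representatives. -/
theorem eventually_ultraOut_comp {k : ℕ} (f : Fin k → ∀ i, M i) :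
    ∀ᶠ i in U, (fun x => ultraOut U x i) ∘ (fun j => ultraMk U (f j)) = fun j => f j i := by
  have := eventually_all.2 fun j => ultraOut_mk U (f j)
  filter_upwards [this] with i hi
  exact funext hi

theorem ultraproduct_pos {k : ℕ} (R : τ.Relations k) (f : Fin k → ∀ i, M i) :
    ultraproduct U P (.pos R fun j => ultraMk U (f j)) ↔
      ∀ᶠ i in U, P i (.pos R fun j => f j i) :=
  eventually_congr <| (eventually_ultraOut_comp U f).mono fun i hi => by rw [Lit.map, hi]

theorem ultraproduct_neg {k : ℕ} (R : τ.Relations k) (f : Fin k → ∀ i, M i) :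
    ultraproduct U P (.neg R fun j => ultraMk U (f j)) ↔
      ∀ᶠ i in U, P i (.neg R fun j => f j i) :=
  eventually_congr <| (eventually_ultraOut_comp U f).mono fun i hi => by rw [Lit.map, hi]

theorem consistent_ultraproduct {c : Prop} (hP : ∀ i, Consistent c (P i)) :
    Consistent c (ultraproduct U P) := by
  intro k R a
  refine ⟨fun ⟨h₁, h₂⟩ => ?_, fun hc => ?_⟩
  · obtain ⟨i, hi₁, hi₂⟩ := (h₁.and h₂).exists
    exact (hP i k R _).1 ⟨hi₁, hi₂⟩
  · exact Ultrafilter.eventually_or.1 (Eventually.of_forall fun i => (hP i k R _).2 hc)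

theorem comp_snoc {α β : Type*} (g : α → β) {n : ℕ} (s : Fin n → α) (a : α) :
    g ∘ (Fin.snoc s a : Fin (n + 1) → α) = Fin.snoc (g ∘ s) (g a) := by
  ext j
  refine Fin.lastCases ?_ (fun j => ?_) j <;> simp

/-- Łoś's theorem. -/
theorem eval_ultraproduct [∀ i, Nonempty (M i)] {n : ℕ} (φ : Formula τ n)
    (s : Fin n → ∀ i, M i) :
    eval (ultraproduct U P) φ (ultraMk U ∘ s) ↔
      ∀ᶠ i in U, eval (P i) φ ((fun f => f i) ∘ s) := by
  induction φ with
  | top => simp [eval]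
  | bot => simpa [eval] using U.neBot.ne
  | eq x y => simp [eval, ultraMk_eq]
  | neq x y =>
    simp only [eval, Function.comp_apply, ultraMk_eq]
    simp only [Prop.top_eq_true, Prop.bot_eq_false, if_false_left, and_true]
    rw [ultraMk_eq]
    exact Ultrafilter.eventually_not.symm
  | rel R x => exact ultraproduct_pos U P R fun j => s (x j)
  | nrel R x => exact ultraproduct_neg U P R fun j => s (x j)
  | and φ ψ ih₁ ih₂ =>
    simp only [eval, inf_Prop_eq, eventually_and, ih₁, ih₂]
  | or φ ψ ih₁ ih₂ =>
    simp only [eval, sup_Prop_eq, Ultrafilter.eventually_or, ih₁, ih₂]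
  | all φ ih =>
    have key := fun f : ∀ i, M i => ih (Fin.snoc s f)
    simp only [comp_snoc] at key
    simp only [eval, iInf_Prop_eq]
    refine ⟨fun h => ?_, fun h x => ?_⟩
    -- In each factor take a counterexample if there is one; truth at this element forces truth
    -- everywhere.
    · have (i : I) : ∃ a, eval (P i) φ (Fin.snoc ((fun f => f i) ∘ s) a) →
          ∀ a, eval (P i) φ (Fin.snoc ((fun f => f i) ∘ s) a) := by
        by_cases h : ∃ a, ¬ eval (P i) φ (Fin.snoc ((fun f => f i) ∘ s) a)
        · exact h.imp fun a ha h' => (ha h').elim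
        · exact ⟨Classical.arbitrary _, fun _ a => not_not.1 fun ha => h ⟨a, ha⟩⟩
      choose f hf using this
      exact ((key f).1 (h _)).mono hf
    · rw [← ultraMk_out U x, key]
      exact h.mono fun i hi => hi _
  | ex φ ih =>
    have key := fun f : ∀ i, M i => ih (Fin.snoc s f)
    simp only [comp_snoc] at key
    simp only [eval, iSup_Prop_eq]
    refine ⟨fun ⟨x, hx⟩ => ?_, fun h => ?_⟩
    · rw [← ultraMk_out U x, key] at hx
      exact hx.mono fun i hi => ⟨_, hi⟩
    · have (i : I) : ∃ a, (∃ a, eval (P i) φ (Fin.snoc ((fun f => f i) ∘ s) a)) →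
          eval (P i) φ (Fin.snoc ((fun f => f i) ∘ s) a) := by
        by_cases h : ∃ a, eval (P i) φ (Fin.snoc ((fun f => f i) ∘ s) a)
        · exact h.imp fun a ha _ => ha
        · exact ⟨Classical.arbitrary _, fun h' => (h h').elim⟩
      choose f hf using this
      exact ⟨ultraMk U f, (key f).2 (h.mono hf)⟩

end Ultraproduct

/-! ### Compactness -/

section Compactness

/-- An ultrafilter on the finite subsets of `T` that contains every principal up-set. -/
noncomputable def finsetUltrafilter (T : Type u) : Ultrafilter (Finset T) := Ultrafilter.of atTop

theorem eventually_mem_finsetUltrafilter {T : Type u} (t : T) :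
    ∀ᶠ F in (finsetUltrafilter T : Filter (Finset T)), t ∈ F :=
  Ultrafilter.of_le atTop <|
    (eventually_ge_atTop {t}).mono fun F hF => by simpa using hF

theorem value_ultraproduct {I : Type u} (U : Ultrafilter I) {M : I → Type u}
    [∀ i, Nonempty (M i)] (P : ∀ i, Interp τ (M i) Prop) (φ : Sentence τ) :
    value (ultraproduct U P) φ ↔ ∀ᶠ i in U, value (P i) φ := by
  have h := eval_ultraproduct U P φ Fin.elim0
  have e (C : Type u) (s : Fin 0 → C) : s = Fin.elim0 := Subsingleton.elim _ _
  simpa only [e, value] using h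

instance nonempty_ultraproduct {I : Type u} (U : Ultrafilter I) {M : I → Type u}
    [∀ i, Nonempty (M i)] : Nonempty ((U : Filter I).Product M) :=
  ⟨ultraMk U fun _ => Classical.arbitrary _⟩

/-- The compactness theorem. -/
theorem exists_models_of_finset {c : Prop} {Γ Δ : Set (Sentence τ)}
    (h : ∀ F : Finset (Sentence τ), ∃ (A : Type u) (_ : Nonempty A) (P : Interp τ A Prop),
      Consistent c P ∧ (∀ φ ∈ F, φ ∈ Γ → value P φ) ∧ ∀ φ ∈ F, φ ∈ Δ → ¬ value P φ) :
    ∃ (A : Type u) (_ : Nonempty A) (P : Interp τ A Prop),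
      Consistent c P ∧ Models P Γ ∧ ∀ φ ∈ Δ, ¬ value P φ := by
  -- Falsity of `Δ` is demanded separately: with undetermined atoms it is not the truth of dual
  -- sentences. Łoś's theorem transfers both demands.
  choose M hM P hP hΓ hΔ using h
  refine ⟨_, nonempty_ultraproduct (finsetUltrafilter _), ultraproduct (finsetUltrafilter _) P,
    consistent_ultraproduct _ P hP, fun φ hφ => ?_, fun φ hφ h => ?_⟩
  · rw [value_ultraproduct]
    exact (eventually_mem_finsetUltrafilter φ).mono fun F hF => hΓ F φ hF hφ
  · rw [value_ultraproduct] at h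
    obtain ⟨F, h₁, h₂⟩ := (h.and (eventually_mem_finsetUltrafilter φ)).exists
    exact hΔ F φ h₂ hφ h₁

theorem Entails.exists_finset {c : Prop} {Φ : Set (Sentence τ)} {ψ : Sentence τ}
    (h : Entails c Φ {ψ}) :
    ∃ F : Finset (Sentence τ), (F : Set (Sentence τ)) ⊆ Φ ∧ Entails c F {ψ} := by
  classical
  by_contra hn
  obtain ⟨A, _, P, hP, hΦ, hψ⟩ := exists_models_of_finset (c := c) (Γ := Φ) (Δ := {ψ})
    fun F => by
      have hF : ¬ Entails c (F.filter (· ∈ Φ) : Finset _) {ψ} := fun hF =>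
        hn ⟨F.filter (· ∈ Φ), fun φ hφ => (Finset.mem_filter.1 hφ).2, hF⟩
      simp only [Entails, not_forall] at hF
      obtain ⟨A, hA, P, hP, h₁, h₂⟩ := hF
      refine ⟨A, hA, P, hP, fun φ hφ hφ' => h₁ φ (by simp [hφ, hφ']), ?_⟩
      rintro φ - rfl hv
      exact h₂ fun χ hχ => hχ ▸ hv
  exact hψ ψ rfl (h A P hP hΦ ψ rfl)

end Compactness

/-! ### Quantifier-free fragments -/

section Fragments

/-- Rename the free variables. -/
def Formula.rename : {n : ℕ} → Formula τ n → {m : ℕ} → (Fin n → Fin m) → Formula τ m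
  | _, .top, _, _ => .top
  | _, .bot, _, _ => .bot
  | _, .eq x y, _, f => .eq (f x) (f y)
  | _, .neq x y, _, f => .neq (f x) (f y)
  | _, .rel R x, _, f => .rel R (f ∘ x)
  | _, .nrel R x, _, f => .nrel R (f ∘ x)
  | _, .and φ ψ, _, f => .and (φ.rename f) (ψ.rename f)
  | _, .or φ ψ, _, f => .or (φ.rename f) (ψ.rename f)
  | _, .all φ, m, f => .all (φ.rename (Fin.snoc (Fin.castSucc ∘ f) (Fin.last m)))
  | _, .ex φ, m, f => .ex (φ.rename (Fin.snoc (Fin.castSucc ∘ f) (Fin.last m)))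

variable {S : Type v} [CompleteLattice S]

theorem eval_rename (π : Interp τ A S) {n m : ℕ} (φ : Formula τ n) (f : Fin n → Fin m)
    (s : Fin m → A) : eval π (φ.rename f) s = eval π φ (s ∘ f) := by
  have e {n m : ℕ} (f : Fin n → Fin m) (s : Fin m → A) (a : A) :
      (Fin.snoc s a : Fin (m + 1) → A) ∘
        (Fin.snoc (Fin.castSucc ∘ f) (Fin.last m) : Fin (n + 1) → Fin (m + 1)) =
      Fin.snoc (s ∘ f) a := by
    rw [comp_snoc, ← Function.comp_assoc]
    congr 1
    · ext j
      simp
    · simp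
  induction φ generalizing m with
  | top => rfl
  | bot => rfl
  | eq x y => rfl
  | neq x y => rfl
  | rel R x => rfl
  | nrel R x => rfl
  | and φ ψ ih₁ ih₂ => simp only [Formula.rename, eval, ih₁, ih₂]
  | or φ ψ ih₁ ih₂ => simp only [Formula.rename, eval, ih₁, ih₂]
  | all φ ih => simp only [Formula.rename, eval, ih, e]
  | ex φ ih => simp only [Formula.rename, eval, ih, e]

theorem value_exs (π : Interp τ A S) {n : ℕ} (θ : Formula τ n) :
    value π θ.exs = ⨆ s, eval π θ s := by
  induction n with
  | zero =>
    rw [iSup_unique]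
    exact congrArg (eval π θ) (Subsingleton.elim _ _)
  | succ n ih =>
    rw [Formula.exs, ih]
    simp only [eval]
    refine le_antisymm (iSup_le fun s => iSup_le fun a => le_iSup (eval π θ) _)
      (iSup_le fun s => ?_)
    rw [← Fin.snoc_init_self s]
    exact le_iSup₂_of_le (Fin.init s) (s (Fin.last n)) le_rfl

theorem value_alls (π : Interp τ A S) {n : ℕ} (θ : Formula τ n) :
    value π θ.alls = ⨅ s, eval π θ s := by
  induction n with
  | zero =>
    rw [iInf_unique]
    exact congrArg (eval π θ) (Subsingleton.elim _ _)
  | succ n ih =>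
    rw [Formula.alls, ih]
    simp only [eval]
    refine le_antisymm (le_iInf fun s => ?_)
      (le_iInf fun s => le_iInf fun a => iInf_le (eval π θ) _)
    rw [← Fin.snoc_init_self s]
    exact iInf₂_le_of_le (Fin.init s) (s (Fin.last n)) le_rfl

theorem value_exs_iff (P : Interp τ A Prop) {n : ℕ} (θ : Formula τ n) :
    value P θ.exs ↔ ∃ s, eval P θ s := by rw [value_exs, iSup_Prop_eq]

theorem value_alls_iff (P : Interp τ A Prop) {n : ℕ} (θ : Formula τ n) :
    value P θ.alls ↔ ∀ s, eval P θ s := by rw [value_alls, iInf_Prop_eq]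

/-- The set of formulae contains, up to equivalence, all finite conjunctions of its members. -/
def ClosedUnderConj {n : ℕ} (Q : Set (Formula τ n)) : Prop :=
  ∀ F : Finset (Formula τ n), (F : Set (Formula τ n)) ⊆ Q → ∃ χ ∈ Q, ∀ (A : Type u) [Nonempty A]
    (P : Interp τ A Prop) (s : Fin n → A), eval P χ s ↔ ∀ φ ∈ F, eval P φ s

/-- The set of formulae contains, up to equivalence, all finite disjunctions of its members. -/
def ClosedUnderDisj {n : ℕ} (Q : Set (Formula τ n)) : Prop :=
  ∀ F : Finset (Formula τ n), (F : Set (Formula τ n)) ⊆ Q → ∃ χ ∈ Q, ∀ (A : Type u) [Nonempty A]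
    (P : Interp τ A Prop) (s : Fin n → A), eval P χ s ↔ ∃ φ ∈ F, eval P φ s

theorem closedUnderConj_of_binary {n : ℕ} {Q : Set (Formula τ n)} (h₀ : .top ∈ Q)
    (h₂ : ∀ φ ∈ Q, ∀ ψ ∈ Q, ∃ χ ∈ Q, ∀ (A : Type u) [Nonempty A] (P : Interp τ A Prop)
      (s : Fin n → A), eval P χ s ↔ eval P φ s ∧ eval P ψ s) : ClosedUnderConj Q := by
  classical
  intro F
  induction F using Finset.induction with
  | empty => exact fun _ => ⟨_, h₀, fun _ _ _ _ => by simp [eval]⟩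
  | insert φ F _ ih =>
    intro hF
    rw [Finset.coe_insert, Set.insert_subset_iff] at hF
    obtain ⟨χ, hχ, h⟩ := ih hF.2
    obtain ⟨χ', hχ', h'⟩ := h₂ φ hF.1 χ hχ
    exact ⟨χ', hχ', fun A _ P s => by rw [h', h, Finset.forall_mem_insert]⟩

theorem closedUnderDisj_of_binary {n : ℕ} {Q : Set (Formula τ n)} (h₀ : .bot ∈ Q)
    (h₂ : ∀ φ ∈ Q, ∀ ψ ∈ Q, ∃ χ ∈ Q, ∀ (A : Type u) [Nonempty A] (P : Interp τ A Prop)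
      (s : Fin n → A), eval P χ s ↔ eval P φ s ∨ eval P ψ s) : ClosedUnderDisj Q := by
  classical
  intro F
  induction F using Finset.induction with
  | empty => exact fun _ => ⟨_, h₀, fun _ _ _ _ => by simp [eval]⟩
  | insert φ F _ ih =>
    intro hF
    rw [Finset.coe_insert, Set.insert_subset_iff] at hF
    obtain ⟨χ, hχ, h⟩ := ih hF.2
    obtain ⟨χ', hχ', h'⟩ := h₂ φ hF.1 χ hχ
    exact ⟨χ', hχ', fun A _ P s => by rw [h', h, Finset.exists_mem_insert]⟩

/-- A class of formulae closed under positive Boolean combinations and renaming. -/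
structure IsFragment (D : ∀ n, Set (Formula τ n)) : Prop where
  top : ∀ n, .top ∈ D n
  bot : ∀ n, .bot ∈ D n
  and : ∀ {n φ ψ}, φ ∈ D n → ψ ∈ D n → .and φ ψ ∈ D n
  or : ∀ {n φ ψ}, φ ∈ D n → ψ ∈ D n → .or φ ψ ∈ D n
  rename : ∀ {n m φ} (f : Fin n → Fin m), φ ∈ D n → φ.rename f ∈ D m

/-- The existential closures of the formulae of a class. -/
def ExClosures (D : ∀ n, Set (Formula τ n)) : Set (Sentence τ) :=
  {ψ | ∃ (n : ℕ) (θ : Formula τ n), θ ∈ D n ∧ ψ = θ.exs}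

/-- The universal closures of the formulae of a class. -/
def AllClosures (D : ∀ n, Set (Formula τ n)) : Set (Sentence τ) :=
  {ψ | ∃ (n : ℕ) (θ : Formula τ n), θ ∈ D n ∧ ψ = θ.alls}

namespace IsFragment

variable {D : ∀ n, Set (Formula τ n)} (hD : IsFragment D)
include hD

theorem closedUnderConj (n : ℕ) : ClosedUnderConj (D n) :=
  closedUnderConj_of_binary (hD.top n) fun _ hφ _ hψ => ⟨_, hD.and hφ hψ, fun _ _ _ _ => Iff.rfl⟩

theorem closedUnderDisj (n : ℕ) : ClosedUnderDisj (D n) :=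
  closedUnderDisj_of_binary (hD.bot n) fun _ hφ _ hψ => ⟨_, hD.or hφ hψ, fun _ _ _ _ => Iff.rfl⟩

theorem closedUnderConj_exClosures : ClosedUnderConj (ExClosures D) := by
  refine closedUnderConj_of_binary ⟨0, .top, hD.top 0, rfl⟩ ?_
  rintro _ ⟨n, θ, hθ, rfl⟩ _ ⟨m, θ', hθ', rfl⟩
  refine ⟨_, ⟨n + m, .and (θ.rename (Fin.castAdd m)) (θ'.rename (Fin.natAdd n)),
    hD.and (hD.rename _ hθ) (hD.rename _ hθ'), rfl⟩, fun A _ P s => ?_⟩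
  obtain rfl : s = Fin.elim0 := Subsingleton.elim _ _
  simp only [← value.eq_1, value_exs_iff, eval, eval_rename, inf_Prop_eq]
  constructor
  · rintro ⟨s, h, h'⟩
    exact ⟨⟨_, h⟩, _, h'⟩
  · rintro ⟨⟨s, h⟩, s', h'⟩
    refine ⟨Fin.append s s', ?_, ?_⟩
    · convert h
      ext i; simp
    · convert h'
      ext i; simp

theorem closedUnderDisj_exClosures : ClosedUnderDisj (ExClosures D) := by
  refine closedUnderDisj_of_binary ⟨0, .bot, hD.bot 0, rfl⟩ ?_
  rintro _ ⟨n, θ, hθ, rfl⟩ _ ⟨m, θ', hθ', rfl⟩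
  refine ⟨_, ⟨n + m, .or (θ.rename (Fin.castAdd m)) (θ'.rename (Fin.natAdd n)),
    hD.or (hD.rename _ hθ) (hD.rename _ hθ'), rfl⟩, fun A _ P s => ?_⟩
  obtain rfl : s = Fin.elim0 := Subsingleton.elim _ _
  simp only [← value.eq_1, value_exs_iff, eval, eval_rename, sup_Prop_eq]
  constructor
  · rintro ⟨s, h | h⟩
    · exact Or.inl ⟨_, h⟩
    · exact Or.inr ⟨_, h⟩
  · rintro (⟨s, h⟩ | ⟨s, h⟩)
    -- The other disjunct's variables may take any value; this needs a non-empty universe.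
    · refine ⟨Fin.append s fun _ => Classical.arbitrary A, Or.inl ?_⟩
      convert h
      ext i; simp
    · refine ⟨Fin.append (fun _ => Classical.arbitrary A) s, Or.inr ?_⟩
      convert h
      ext i; simp

theorem closedUnderConj_allClosures : ClosedUnderConj (AllClosures D) := by
  refine closedUnderConj_of_binary ⟨0, .top, hD.top 0, rfl⟩ ?_
  rintro _ ⟨n, θ, hθ, rfl⟩ _ ⟨m, θ', hθ', rfl⟩
  refine ⟨_, ⟨n + m, .and (θ.rename (Fin.castAdd m)) (θ'.rename (Fin.natAdd n)),
    hD.and (hD.rename _ hθ) (hD.rename _ hθ'), rfl⟩, fun A _ P s => ?_⟩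
  obtain rfl : s = Fin.elim0 := Subsingleton.elim _ _
  simp only [← value.eq_1, value_alls_iff, eval, eval_rename, inf_Prop_eq]
  constructor
  · refine fun h => ⟨fun s => ?_, fun s => ?_⟩
    · convert (h (Fin.append s fun _ => Classical.arbitrary A)).1
      ext i; simp
    · convert (h (Fin.append (fun _ => Classical.arbitrary A) s)).2
      ext i; simp
  · exact fun h s => ⟨h.1 _, h.2 _⟩

end IsFragment

theorem isFragment_quantifierFree :
    IsFragment fun n => {θ : Formula τ n | θ.QuantifierFree} where
  top _ := trivial
  bot _ := trivial
  and h₁ h₂ := ⟨h₁, h₂⟩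
  or h₁ h₂ := ⟨h₁, h₂⟩
  rename {n m φ} f h := by
    simp only [Set.mem_ofPred_eq] at h ⊢
    induction φ generalizing m with
    | and φ ψ ih₁ ih₂ => exact ⟨ih₁ f h.1, ih₂ f h.2⟩
    | or φ ψ ih₁ ih₂ => exact ⟨ih₁ f h.1, ih₂ f h.2⟩
    | all φ => exact h.elim
    | ex φ => exact h.elim
    | _ => trivial

theorem isFragment_positive :
    IsFragment fun n => {θ : Formula τ n | θ.QuantifierFree ∧ θ.NegationFree} where
  top _ := ⟨trivial, trivial⟩
  bot _ := ⟨trivial, trivial⟩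
  and h₁ h₂ := ⟨⟨h₁.1, h₂.1⟩, h₁.2, h₂.2⟩
  or h₁ h₂ := ⟨⟨h₁.1, h₂.1⟩, h₁.2, h₂.2⟩
  rename {n m φ} f h := by
    refine ⟨isFragment_quantifierFree.rename f h.1, ?_⟩
    replace h := h.2
    induction φ generalizing m with
    | and φ ψ ih₁ ih₂ => exact ⟨ih₁ f h.1, ih₂ f h.2⟩
    | or φ ψ ih₁ ih₂ => exact ⟨ih₁ f h.1, ih₂ f h.2⟩
    | all φ ih => exact ih _ h
    | ex φ ih => exact ih _ h
    | neq => exact h.elim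
    | nrel => exact h.elim
    | _ => trivial

end Fragments

/-! ### Preservation along maps -/

section Maps

theorem exists_retraction [Nonempty A] (F : Finset A) :
    ∃ (n : ℕ) (t : Fin n → A) (g : A → Fin n), ∀ a ∈ F, t (g a) = a := by
  classical
  -- The added element supplies the index to which `g` sends everything outside `F'`.
  let F' := insert (Classical.arbitrary A) F
  let e := F'.equivFin
  refine ⟨F'.card, fun i => e.symm i,
    fun a => if h : a ∈ F' then e ⟨a, h⟩ else e ⟨Classical.arbitrary A, by simp [F']⟩, ?_⟩
  intro a ha
  have : a ∈ F' := by simp [F', ha]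
  simp [this]

/-- Replaces parameters by variables: renaming along `g ∘ s` puts finitely many instantiated
formulae into common variables, and the assignment `t` restores their instances. -/
theorem exists_retraction_of_assignments [Nonempty A]
    (F : Finset (Σ n, Formula τ n × (Fin n → A))) :
    ∃ (n : ℕ) (t : Fin n → A) (g : A → Fin n), ∀ f ∈ F, t ∘ g ∘ f.2.2 = f.2.2 := by
  classical
  obtain ⟨n, t, g, h⟩ := exists_retraction (F.biUnion fun f => Finset.univ.image f.2.2)
  refine ⟨n, t, g, fun f hf => funext fun i => h _ ?_⟩
  simp only [Finset.mem_biUnion, Finset.mem_image, Finset.mem_univ, true_and]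
  exact ⟨f, hf, i, rfl⟩

variable {D : ∀ n, Set (Formula τ n)}

/-- The truth of the set of sentences is preserved by all maps that preserve the truth of the
formulae in `D`. -/
def PreservedAlong (c : Prop) (D : ∀ n, Set (Formula τ n)) (Φ : Set (Sentence τ)) : Prop :=
  ∀ (A B : Type u) [Nonempty A] [Nonempty B] (P : Interp τ A Prop) (Q : Interp τ B Prop),
    Consistent c P → Consistent c Q → ∀ j : A → B,
      (∀ (n : ℕ), ∀ θ ∈ D n, ∀ s, eval P θ s → eval Q θ (j ∘ s)) → Models P Φ → Models Q Φ

/-- The truth of the set of sentences is reflected by all maps that reflect the truth of the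
formulae in `D`. -/
def ReflectedAlong (c : Prop) (D : ∀ n, Set (Formula τ n)) (Φ : Set (Sentence τ)) : Prop :=
  ∀ (A B : Type u) [Nonempty A] [Nonempty B] (P : Interp τ A Prop) (Q : Interp τ B Prop),
    Consistent c P → Consistent c Q → ∀ j : A → B,
      (∀ (n : ℕ), ∀ θ ∈ D n, ∀ s, eval Q θ (j ∘ s) → eval P θ s) → Models Q Φ → Models P Φ

/-- The existential closure of a finite part of the `D`-diagram of `P` holds in `P`, hence in `Q`;
witnesses in `Q` define the map. -/
theorem exists_map_finset_of_exClosures (hD : IsFragment D) [Nonempty A] [Nonempty B]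
    {P : Interp τ A Prop} {Q : Interp τ B Prop}
    (h : ∀ χ ∈ ExClosures D, value P χ → value Q χ)
    (F : Finset (Σ n, Formula τ n × (Fin n → A))) :
    ∃ j : A → B, ∀ f ∈ F, f.2.1 ∈ D f.1 → eval P f.2.1 f.2.2 → eval Q f.2.1 (j ∘ f.2.2) := by
  classical
  obtain ⟨n, t, g, ht⟩ := exists_retraction_of_assignments F
  obtain ⟨χ, hχ, hχ'⟩ := hD.closedUnderConj n
    ((F.filter fun f : Σ n, Formula τ n × (Fin n → A) => f.2.1 ∈ D f.1 ∧ eval P f.2.1 f.2.2).image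
      fun f : Σ n, Formula τ n × (Fin n → A) => f.2.1.rename (g ∘ f.2.2)) (by
    intro θ hθ
    simp only [Finset.coe_image, Finset.coe_filter, Set.mem_image, Set.mem_ofPred_eq] at hθ
    obtain ⟨f, ⟨-, hf, -⟩, rfl⟩ := hθ
    exact hD.rename _ hf)
  simp only [Finset.forall_mem_image, Finset.mem_filter, eval_rename] at hχ'
  have := h χ.exs ⟨n, χ, hχ, rfl⟩
  rw [value_exs_iff, value_exs_iff] at this
  obtain ⟨t', ht'⟩ := this ⟨t, (hχ' A P t).2 fun f hf => (ht f hf.1).symm ▸ hf.2.2⟩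
  exact ⟨t' ∘ g, fun f hf h₁ h₂ => (hχ' B Q t').1 ht' ⟨hf, h₁, h₂⟩⟩

theorem exists_ultrapower_map_of_exClosures (hD : IsFragment D) [Nonempty A] [Nonempty B]
    {P : Interp τ A Prop} {Q : Interp τ B Prop}
    (h : ∀ χ ∈ ExClosures D, value P χ → value Q χ) :
    ∃ (I : Type u) (U : Ultrafilter I) (j : A → (U : Filter I).Product fun _ => B),
      ∀ (n : ℕ), ∀ θ ∈ D n, ∀ s, eval P θ s → eval (ultraproduct U fun _ => Q) θ (j ∘ s) := by
  choose j hj using exists_map_finset_of_exClosures hD h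
  refine ⟨_, finsetUltrafilter _, fun a => ultraMk _ fun F => j F a, fun n θ hθ s hs => ?_⟩
  refine (eval_ultraproduct _ (fun _ => Q) θ fun i F => j F (s i)).2 ?_
  exact (eventually_mem_finsetUltrafilter ⟨n, θ, s⟩).mono fun F hF => hj F _ hF hθ hs

theorem PreservedAlong.exists_exClosures {c : Prop} (hD : IsFragment D) {Φ : Set (Sentence τ)}
    (hΦ : PreservedAlong c D Φ) :
    ∃ Ψ ⊆ ExClosures D, Entails c Φ Ψ ∧ Entails c Ψ Φ := by
  classical
  -- Given a model `Q` of these consequences, it suffices to find a model of `Φ` whose true closures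
  -- all hold in `Q`: it maps to an ultrapower of `Q`, which has the same true sentences as `Q`.
  refine ⟨{χ ∈ ExClosures D | Entails c Φ {χ}}, fun χ hχ => hχ.1,
    fun A _ P hP h χ hχ => hχ.2 A P hP h χ rfl, fun B _ Q hQ hB => ?_⟩
  obtain ⟨A, _, P, hP, hA, hAB⟩ := exists_models_of_finset (c := c) (Γ := Φ)
    (Δ := {χ ∈ ExClosures D | ¬ value Q χ}) fun F => by
      by_contra hn
      push Not at hn
      -- If no model of `Φ` falsified these finitely many closures, their disjunction would follow
      -- from `Φ` and so hold in `Q`, where each of them is false.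
      obtain ⟨χ, hχ, hχ'⟩ := hD.closedUnderDisj_exClosures
        (F.filter fun χ => χ ∈ ExClosures D ∧ ¬ value Q χ) (by
          intro χ hχ
          simp only [Finset.coe_filter, Set.mem_ofPred_eq] at hχ
          exact hχ.2.1)
      have hQχ : value Q χ := hB χ ⟨hχ, fun A hA P hP h => by
        rintro _ rfl
        obtain ⟨φ, hφ, hφ', hv⟩ := hn A hA P hP fun φ _ hφ => h φ hφ
        exact (hχ' A P _).2 ⟨φ, Finset.mem_filter.2 ⟨hφ, hφ'⟩, hv⟩⟩
      obtain ⟨φ, hφ, hv⟩ := (hχ' B Q _).1 hQχ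
      exact (Finset.mem_filter.1 hφ).2.2 hv
  obtain ⟨I, U, j, hj⟩ := exists_ultrapower_map_of_exClosures hD (P := P) (Q := Q)
    fun χ hχ hv => by_contra fun h => hAB χ ⟨hχ, h⟩ hv
  have := hΦ A _ P _ hP (consistent_ultraproduct U _ fun _ => hQ) j hj hA
  intro φ hφ
  have hφ := this φ hφ
  rw [value_ultraproduct] at hφ
  exact hφ.exists.choose_spec

theorem ReflectedAlong.exists_allClosures {c : Prop} (hD : IsFragment D) {Φ : Set (Sentence τ)}
    (hΦ : ReflectedAlong c D Φ) :
    ∃ Ψ ⊆ AllClosures D, Entails c Φ Ψ ∧ Entails c Ψ Φ := by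
  classical
  refine ⟨{χ ∈ AllClosures D | Entails c Φ {χ}}, fun χ hχ => hχ.1,
    fun A _ P hP h χ hχ => hχ.2 A P hP h χ rfl, fun A _ P hP hA => ?_⟩
  have (F : Finset (Σ n, Formula τ n × (Fin n → A))) :
      ∃ (B : Type u) (_ : Nonempty B) (Q : Interp τ B Prop) (j : A → B), Consistent c Q ∧
        Models Q Φ ∧
        ∀ f ∈ F, f.2.1 ∈ D f.1 → ¬ eval P f.2.1 f.2.2 → ¬ eval Q f.2.1 (j ∘ f.2.2) := by
    by_contra hn
    push Not at hn
    obtain ⟨n, t, g, ht⟩ := exists_retraction_of_assignments F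
    -- Were every map into a model of `Φ` to make one of these formulae true, the universal closure
    -- of their disjunction would follow from `Φ`; yet it fails in `P` at `t`.
    obtain ⟨χ, hχ, hχ'⟩ := hD.closedUnderDisj n
      ((F.filter fun f : Σ n, Formula τ n × (Fin n → A) => f.2.1 ∈ D f.1 ∧ ¬ eval P f.2.1 f.2.2).image
        fun f : Σ n, Formula τ n × (Fin n → A) => f.2.1.rename (g ∘ f.2.2)) (by
      intro θ hθ
      simp only [Finset.coe_image, Finset.coe_filter, Set.mem_image, Set.mem_ofPred_eq] at hθ
      obtain ⟨f, ⟨-, hf, -⟩, rfl⟩ := hθ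
      exact hD.rename _ hf)
    simp only [Finset.exists_mem_image, Finset.mem_filter, eval_rename] at hχ'
    have hPχ : value P χ.alls := hA χ.alls ⟨⟨n, χ, hχ, rfl⟩, fun B hB Q hQ h => by
      rintro _ rfl
      rw [value_alls_iff]
      intro t'
      obtain ⟨f, hf, h₁, h₂, h₃⟩ := hn B hB Q (t' ∘ g) hQ h
      exact (hχ' B Q t').2 ⟨f, ⟨hf, h₁, h₂⟩, h₃⟩⟩
    rw [value_alls_iff] at hPχ
    obtain ⟨f, ⟨hf, -, h₁⟩, h₂⟩ := (hχ' A P t).1 (hPχ t)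
    rw [ht f hf] at h₂
    exact h₁ h₂
  choose B hB Q j hQ hQΦ hj using this
  refine hΦ A _ P (ultraproduct (finsetUltrafilter _) Q) hP (consistent_ultraproduct _ Q hQ)
    (fun a => ultraMk _ fun F => j F a) (fun n θ hθ s hs => ?_) fun φ hφ => ?_
  · by_contra hn
    have h := (eval_ultraproduct _ Q θ fun i F => j F (s i)).1 hs
    obtain ⟨F, h₁, h₂⟩ := (h.and (eventually_mem_finsetUltrafilter ⟨n, θ, s⟩)).exists
    exact hj F _ h₂ hθ hn h₁
  · rw [value_ultraproduct]
    exact Eventually.of_forall fun F => hQΦ F φ hφ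

/-- A sentence that is equivalent to a subset of a set closed under conjunctions is equivalent to
a member of that set. -/
theorem exists_mem_of_entails {c : Prop} {Q : Set (Sentence τ)} (hQ : ClosedUnderConj Q)
    {ψ : Sentence τ} (h : ∃ Ψ ⊆ Q, Entails c {ψ} Ψ ∧ Entails c Ψ {ψ}) :
    ∃ χ ∈ Q, Entails c {ψ} {χ} ∧ Entails c {χ} {ψ} := by
  obtain ⟨Ψ, hΨ, h₁, h₂⟩ := h
  obtain ⟨F, hF, h₃⟩ := h₂.exists_finset
  obtain ⟨χ, hχ, hχ'⟩ := hQ F (hF.trans hΨ)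
  refine ⟨χ, hχ, fun A _ P hP h => ?_, fun A _ P hP h => ?_⟩
  · rintro _ rfl
    exact (hχ' A P _).2 fun φ hφ => h₁ A P hP h φ (hF hφ)
  · exact h₃ A P hP fun φ hφ => (hχ' A P _).1 (h χ rfl) φ hφ

end Maps

/-! ### Syntactic classes are preserved -/

section Soundness

variable {S : Type v} [CompleteLattice S]

theorem eval_le_of_isHom {πA : Interp τ A S} {πB : Interp τ B S} {g : A → B}
    (h : IsHom πA πB g) {n : ℕ} {θ : Formula τ n} (hθ : θ.QuantifierFree) (hθ' : θ.NegationFree)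
    (s : Fin n → A) : eval πA θ s ≤ eval πB θ (g ∘ s) := by
  rw [isHom_iff] at h
  induction θ with
  | top => exact le_rfl
  | bot => exact le_rfl
  | eq x y =>
    by_cases hxy : s x = s y
    · simp [eval, hxy]
    · simp [eval, hxy]
  | neq x y => exact hθ'.elim
  | rel R x => exact h _ R (s ∘ x)
  | nrel R x => exact hθ'.elim
  | and φ ψ ih₁ ih₂ => exact inf_le_inf (ih₁ hθ.1 hθ'.1 s) (ih₂ hθ.2 hθ'.2 s)
  | or φ ψ ih₁ ih₂ => exact sup_le_sup (ih₁ hθ.1 hθ'.1 s) (ih₂ hθ.2 hθ'.2 s)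
  | all φ => exact hθ.elim
  | ex φ => exact hθ.elim

theorem eval_eq_of_isSubinterp {A : Set B} {πA : Interp τ A S} {πB : Interp τ B S}
    (h : IsSubinterp πA πB) {n : ℕ} {θ : Formula τ n} (hθ : θ.QuantifierFree)
    (s : Fin n → A) : eval πA θ s = eval πB θ (Subtype.val ∘ s) := by
  induction θ with
  | top => rfl
  | bot => rfl
  | eq x y => by_cases hxy : s x = s y <;> simp [eval, hxy, Subtype.coe_inj]
  | neq x y => by_cases hxy : s x = s y <;> simp [eval, hxy, Subtype.coe_inj]
  | rel R x => exact h (.pos R (s ∘ x))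
  | nrel R x => exact h (.neg R (s ∘ x))
  | and φ ψ ih₁ ih₂ => exact congrArg₂ _ (ih₁ hθ.1 s) (ih₂ hθ.2 s)
  | or φ ψ ih₁ ih₂ => exact congrArg₂ _ (ih₁ hθ.1 s) (ih₂ hθ.2 s)
  | all φ => exact hθ.elim
  | ex φ => exact hθ.elim

theorem preservedUnderHoms_of_equivalent {Φ Ψ : Set (Sentence τ)} (hΨ : Ψ ⊆ SigmaOnePos τ)
    (h : Equivalent S Φ Ψ) : PreservedUnderHoms S Φ := by
  rintro A B _ _ πA πB hA hB ⟨g, hg⟩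
  rw [h A πA hA, h B πB hB]
  refine iInf₂_mono fun ψ hψ => ?_
  obtain ⟨n, θ, h₁, h₂, rfl⟩ := hΨ hψ
  rw [value_exs, value_exs]
  exact iSup_le fun s => le_iSup_of_le (g ∘ s) (eval_le_of_isHom hg h₁ h₂ s)

theorem preservedUnderExtensions_of_equivalent {Φ Ψ : Set (Sentence τ)} (hΨ : Ψ ⊆ SigmaOne τ)
    (h : Equivalent S Φ Ψ) : PreservedUnderExtensions S Φ := by
  intro B A _ πA πB hA hB hAB
  have : Nonempty B := Nonempty.map Subtype.val ‹Nonempty A›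
  rw [h A πA hA, h B πB hB]
  refine iInf₂_mono fun ψ hψ => ?_
  obtain ⟨n, θ, hθ, rfl⟩ := hΨ hψ
  rw [value_exs, value_exs]
  exact iSup_le fun s => le_iSup_of_le (Subtype.val ∘ s) (eval_eq_of_isSubinterp hAB hθ s).le

theorem preservedUnderSubinterps_of_equivalent {Φ Ψ : Set (Sentence τ)} (hΨ : Ψ ⊆ PiOne τ)
    (h : Equivalent S Φ Ψ) : PreservedUnderSubinterps S Φ := by
  intro B A _ πA πB hA hB hAB
  have : Nonempty B := Nonempty.map Subtype.val ‹Nonempty A›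
  rw [h A πA hA, h B πB hB]
  refine iInf₂_mono fun ψ hψ => ?_
  obtain ⟨n, θ, hθ, rfl⟩ := hΨ hψ
  rw [value_alls, value_alls]
  exact le_iInf fun s => iInf_le_of_le (Subtype.val ∘ s) (eval_eq_of_isSubinterp hAB hθ s).ge

end Soundness

/-! ### From lattice-valued preservation to preservation of truth -/

section Completeness

theorem Lit.map_map {C : Type u} (f : A → B) (g : B → C) (l : Lit τ A) :
    (l.map f).map g = l.map (g ∘ f) := by
  cases l <;> rfl

theorem Lit.map_id (l : Lit τ A) : l.map id = l := by
  cases l <;> rfl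

/-- Negation normal form makes evaluation monotone in the literals, so atoms undetermined in `P` may
become determined in `Q`; bijectivity takes care of equality and quantifiers. -/
theorem eval_mono_of_equiv {P : Interp τ A Prop} {Q : Interp τ B Prop} (e : A ≃ B)
    (h : ∀ l, P l → Q (l.map e)) {n : ℕ} (φ : Formula τ n) (s : Fin n → A)
    (hs : eval P φ s) : eval Q φ (e ∘ s) := by
  induction φ with
  | top => trivial
  | bot => exact hs.elim
  | eq x y => simpa [eval] using hs
  | neq x y => simpa [eval] using hs
  | rel R x => exact h (.pos R (s ∘ x)) hs
  | nrel R x => exact h (.neg R (s ∘ x)) hs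
  | and φ ψ ih₁ ih₂ => exact ⟨ih₁ s hs.1, ih₂ s hs.2⟩
  | or φ ψ ih₁ ih₂ => exact hs.imp (ih₁ s) (ih₂ s)
  | all φ ih =>
    simp only [eval, iInf_Prop_eq] at hs ⊢
    intro b
    have := ih _ (hs (e.symm b))
    rwa [comp_snoc, e.apply_symm_apply] at this
  | ex φ ih =>
    simp only [eval, iSup_Prop_eq] at hs ⊢
    obtain ⟨a, ha⟩ := hs
    have := ih _ ha
    rw [comp_snoc] at this
    exact ⟨_, this⟩

theorem Models.of_equiv {P : Interp τ A Prop} {Q : Interp τ B Prop} (e : A ≃ B)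
    (h : ∀ l, P l → Q (l.map e)) {Φ : Set (Sentence τ)} (hP : Models P Φ) : Models Q Φ := by
  intro φ hφ
  have := eval_mono_of_equiv e h φ _ (hP φ hφ)
  rwa [Subsingleton.elim (e ∘ Fin.elim0) Fin.elim0] at this

/-- The restriction of an interpretation to a subset of its universe. -/
def restrict {S : Type v} (C : Set B) (P : Interp τ B S) : Interp τ C S :=
  fun l => P (l.map Subtype.val)

theorem consistent_restrict {c : Prop} {Q : Interp τ B Prop} (hQ : Consistent c Q) (C : Set B) :
    Consistent c (restrict C Q) :=
  fun k R a => hQ k R (Subtype.val ∘ a)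

variable {S : Type v} [CompleteLattice S]

theorem isSubinterp_thresholdInterp_restrict (a : S) (Q : Interp τ B Prop) (C : Set B) :
    IsSubinterp (thresholdInterp a (restrict C Q)) (thresholdInterp a Q) := by
  intro l
  cases l <;> rfl

variable [Nontrivial S] {Φ : Set (Sentence τ)}

/-- Threshold interpretations give atoms only the values `⊤` and `⊥`, so preserving true atoms is
enough for a homomorphism. -/
theorem PreservedUnderHoms.preservedAlong (h : PreservedUnderHoms S Φ) :
    PreservedAlong (TwoValued S) (fun n => {θ : Formula τ n | θ.QuantifierFree ∧ θ.NegationFree})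
      Φ := by
  intro A B _ _ P Q hP hQ j hj hA
  obtain ⟨a, ha, ha'⟩ := exists_threshold S
  refine models_of_top_le_setValue ha hQ ?_
  rw [← setValue_thresholdInterp_eq_top a hP hA]
  refine h A B _ _ (modelDefining_thresholdInterp ha' hP) (modelDefining_thresholdInterp ha' hQ)
    ⟨j, (isHom_iff _ _ _).2 fun k R x => ?_⟩
  by_cases hx : P (.pos R x)
  · have : Q (.pos R (j ∘ x)) := hj k (.rel R id) ⟨trivial, trivial⟩ x hx
    simp [thresholdInterp, this]
  · simp [thresholdInterp, hx]

/-- Preserving `≠` makes `j` injective. The restriction of `Q` to its range inherits every true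
literal of `P`, so it models `Φ`, and `Q` extends it. -/
theorem PreservedUnderExtensions.preservedAlong (h : PreservedUnderExtensions S Φ) :
    PreservedAlong (TwoValued S) (fun n => {θ : Formula τ n | θ.QuantifierFree}) Φ := by
  intro A B _ _ P Q hP hQ j hj hA
  obtain ⟨a, ha, ha'⟩ := exists_threshold S
  have hinj : Function.Injective j := by
    intro x y hxy
    by_contra hne
    have := hj 2 (.neq 0 1) trivial ![x, y] (by simp [eval, hne])
    simp [eval, hxy] at this
  have hC : Models (restrict (Set.range j) Q) Φ := by
    refine hA.of_equiv (Equiv.ofInjective j hinj) fun l hl => ?_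
    rw [restrict, Lit.map_map]
    cases l with
    | pos R x => exact hj _ (.rel R id) trivial x hl
    | neg R x => exact hj _ (.nrel R id) trivial x hl
  have hC' := consistent_restrict hQ (Set.range j)
  refine models_of_top_le_setValue ha hQ ?_
  rw [← setValue_thresholdInterp_eq_top a hC' hC]
  exact h B _ _ _ (modelDefining_thresholdInterp ha' hC') (modelDefining_thresholdInterp ha' hQ)
    (isSubinterp_thresholdInterp_restrict a Q _)

/-- Reflecting `=` makes `j` injective. Truth of `Φ` passes from `Q` to its restriction to the
range, then along the inverse of `j`, since true literals are reflected. -/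
theorem PreservedUnderSubinterps.reflectedAlong (h : PreservedUnderSubinterps S Φ) :
    ReflectedAlong (TwoValued S) (fun n => {θ : Formula τ n | θ.QuantifierFree}) Φ := by
  intro A B _ _ P Q hP hQ j hj hB
  obtain ⟨a, ha, ha'⟩ := exists_threshold S
  have hinj : Function.Injective j := by
    intro x y hxy
    have := hj 2 (.eq 0 1) trivial ![x, y] (by simp [eval, hxy])
    by_contra hne
    simp [eval, hne] at this
  have hC' := consistent_restrict hQ (Set.range j)
  have hC : Models (restrict (Set.range j) Q) Φ := by
    refine models_of_top_le_setValue ha hC' ?_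
    rw [← setValue_thresholdInterp_eq_top a hQ hB]
    exact h B _ _ _ (modelDefining_thresholdInterp ha' hC') (modelDefining_thresholdInterp ha' hQ)
      (isSubinterp_thresholdInterp_restrict a Q _)
  let e := Equiv.ofInjective j hinj
  refine hC.of_equiv e.symm fun l hl => ?_
  obtain ⟨l, rfl⟩ : ∃ l', l = l'.map e :=
    ⟨l.map e.symm, by rw [Lit.map_map, Equiv.self_comp_symm, Lit.map_id]⟩
  rw [restrict, Lit.map_map] at hl
  rw [Lit.map_map, Equiv.symm_comp_self, Lit.map_id]
  cases l with
  | pos R x => exact hj _ (.rel R id) trivial x hl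
  | neg R x => exact hj _ (.nrel R id) trivial x hl

end Completeness

/-! ### Assembling the characterizations -/

theorem sigmaOnePos_eq_exClosures : SigmaOnePos τ =
    ExClosures fun n => {θ : Formula τ n | θ.QuantifierFree ∧ θ.NegationFree} := by
  simp only [SigmaOnePos, ExClosures, Set.mem_ofPred_eq, and_assoc]

theorem exists_subset_equivalent {S : Type v} [CompletelyDistribLattice S]
    {Φ Q : Set (Sentence τ)}
    (h : ∃ Ψ ⊆ Q, Entails (TwoValued S) Φ Ψ ∧ Entails (TwoValued S) Ψ Φ) :
    ∃ Ψ ⊆ Q, Equivalent S Φ Ψ :=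
  h.imp fun _ h => ⟨h.1, equivalent_of_entails h.2.1 h.2.2⟩

theorem exists_mem_equivalent {S : Type v} [CompletelyDistribLattice S]
    {ψ : Sentence τ} {Q : Set (Sentence τ)} (hQ : ClosedUnderConj Q)
    (h : ∃ Ψ ⊆ Q, Entails (TwoValued S) {ψ} Ψ ∧ Entails (TwoValued S) Ψ {ψ}) :
    ∃ φ ∈ Q, Equivalent S {ψ} {φ} :=
  (exists_mem_of_entails hQ h).imp fun _ h => ⟨h.1, equivalent_of_entails h.2.1 h.2.2⟩

end SemiringSemantics

open SemiringSemantics in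
theorem mainTheorem1 (τ : FirstOrder.Language.{w, u}) [τ.IsRelational]
    (𝓛 : Type v) [CompletelyDistribLattice 𝓛] [Nontrivial 𝓛] :
    (∀ ψ : SemiringSemantics.Sentence τ,
      (SemiringSemantics.PreservedUnderHoms 𝓛 {ψ} ↔
        ∃ φ ∈ SemiringSemantics.SigmaOnePos τ, SemiringSemantics.Equivalent 𝓛 {ψ} {φ}) ∧
      (SemiringSemantics.PreservedUnderExtensions 𝓛 {ψ} ↔
        ∃ φ ∈ SemiringSemantics.SigmaOne τ, SemiringSemantics.Equivalent 𝓛 {ψ} {φ}) ∧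
      (SemiringSemantics.PreservedUnderSubinterps 𝓛 {ψ} ↔
        ∃ φ ∈ SemiringSemantics.PiOne τ, SemiringSemantics.Equivalent 𝓛 {ψ} {φ})) ∧
    (∀ Φ : Set (SemiringSemantics.Sentence τ),
      (SemiringSemantics.PreservedUnderHoms 𝓛 Φ ↔
        ∃ Ψ ⊆ SemiringSemantics.SigmaOnePos τ, SemiringSemantics.Equivalent 𝓛 Φ Ψ) ∧
      (SemiringSemantics.PreservedUnderExtensions 𝓛 Φ ↔
        ∃ Ψ ⊆ SemiringSemantics.SigmaOne τ, SemiringSemantics.Equivalent 𝓛 Φ Ψ) ∧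
      (SemiringSemantics.PreservedUnderSubinterps 𝓛 Φ ↔
        ∃ Ψ ⊆ SemiringSemantics.PiOne τ, SemiringSemantics.Equivalent 𝓛 Φ Ψ)) := by

  have homs {Φ : Set (Sentence τ)} (h : PreservedUnderHoms 𝓛 Φ) :=
    h.preservedAlong.exists_exClosures isFragment_positive
  have exts {Φ : Set (Sentence τ)} (h : PreservedUnderExtensions 𝓛 Φ) :=
    h.preservedAlong.exists_exClosures isFragment_quantifierFree
  have subs {Φ : Set (Sentence τ)} (h : PreservedUnderSubinterps 𝓛 Φ) :=
    h.reflectedAlong.exists_allClosures isFragment_quantifierFree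
  rw [sigmaOnePos_eq_exClosures]
  refine ⟨fun ψ => ⟨⟨fun h => ?_, ?_⟩, ⟨fun h => ?_, ?_⟩, ⟨fun h => ?_, ?_⟩⟩,
    fun Φ => ⟨⟨fun h => ?_, ?_⟩, ⟨fun h => ?_, ?_⟩, ⟨fun h => ?_, ?_⟩⟩⟩
  · exact exists_mem_equivalent isFragment_positive.closedUnderConj_exClosures (homs h)
  · rintro ⟨φ, hφ, h⟩
    exact preservedUnderHoms_of_equivalent (by simpa [sigmaOnePos_eq_exClosures] using hφ) h
  · exact exists_mem_equivalent isFragment_quantifierFree.closedUnderConj_exClosures (exts h)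
  · rintro ⟨φ, hφ, h⟩
    exact preservedUnderExtensions_of_equivalent (Set.singleton_subset_iff.2 hφ) h
  · exact exists_mem_equivalent isFragment_quantifierFree.closedUnderConj_allClosures (subs h)
  · rintro ⟨φ, hφ, h⟩
    exact preservedUnderSubinterps_of_equivalent (Set.singleton_subset_iff.2 hφ) h
  · exact exists_subset_equivalent (homs h)
  · rintro ⟨Ψ, hΨ, h⟩
    exact preservedUnderHoms_of_equivalent (by rwa [sigmaOnePos_eq_exClosures]) h
  · exact exists_subset_equivalent (exts h)
  · rintro ⟨Ψ, hΨ, h⟩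
    exact preservedUnderExtensions_of_equivalent hΨ h
  · exact exists_subset_equivalent (subs h)
  · rintro ⟨Ψ, hΨ, h⟩
    exact preservedUnderSubinterps_of_equivalent hΨ h
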